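/- **Syntax.** Let $\mathbb P$ be a set of propositional variables. Formulas and programs over $\mathbb P$ are given by $$\varphi ::= p \mid \top \mid \lnot\varphi \mid \varphi\lor\varphi \mid \langle\pi\rangle\varphi,$$ $$\pi ::= +_V p \mid -_V p \mid +_R p \mid -_R p \mid +_W p \mid -_W p \mid \varphi? \mid \varphi?\!? \mid \pi;\pi \mid \pi\sqcup\pi \mid \pi^* \mid \pi\parallel\pi$$ with $p\in\mathbb P$. The connectives $\land,\to,\leftrightarrow$ are the usual abbreviations, and $\mathbb P_\pi$ is the finite set of variables occurring in $\pi$. **Models.** A model is a triple $m=(R,W,V)$ of subsets of $\mathbb P$ (readable, writable, true variables) with $W\subseteq R$. Models $m_1,m_2$ are RW-disjoint if $W_1\cap R_2=W_2\cap R_1=\emptyset$. Then - $m$ splits into $m_1,m_2$ iff $m_1,m_2$ are RW-disjoint, $R=R_1\cup R_2$, $W=W_1\cup W_2$ and $V=V_1=V_2$; - $m_1,m_2$ merge into $m$ iff $m_1,m_2$ are RW-disjoint, $R=R_1\cup R_2$, $W=W_1\cup W_2$, $V_1\setminus W=V_2\setminus W$ and $V=(V_1\cap W_1)\cup(V_2\cap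 W_2)\cup(V_1\cap V_2)$; - $m\sim m'$ iff $R=R'$, $W=W'$ and $V\cap R=V'\cap R'$. **Semantics.** $m\models p$ iff $p\in V$; the Boolean connectives are as usual; $m\models\langle\pi\rangle\varphi$ iff $m'\models\varphi$ for some $m'$ with $m[\![\pi]\!]m'$. Programs are relations between models: - $+_Vp$ and $-_Vp$ are executable iff $p\in W$, and add $p$ to, respectively remove $p$ from, $V$; - $+_Rp$ adds $p$ to $R$; $-_Rp$ removes $p$ from $R$ and $W$; $+_Wp$ adds $p$ to $R$ and $W$; $-_Wp$ removes $p$ from $W$ (these four are always executable); - $m[\![\varphi?]\!]m'$ iff $m=m'$ and $m\models\varphi$; $m[\![\varphi?\!?]\!]m'$ iff $m=m'$ and $m''\models\varphi$ for all $m''\sim m$; - $;$, $\sqcup$, ${}^*$ are composition, union and iteration (some $n\ge 0$ times) of relations; - $m[\![\pi_1\parallel\pi_2]\!]m'$ iff there are $m_1,m_2,m_1',m_2'$ such that $m$ splits into $m_1,m_2$, $m_1',m_2'$ merge into $m'$, and for $k=1,2$: $m_k[\![\pi_k]\!]m_k'$, $R_k=R_k'$, $W_k=W_k'$ and $V_k\setminus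 W_k=V_k'\setminus W_k'$. **Flattening.** Let $\mathbb P^+$ consist of $\mathbb P$ and pairwise distinct fresh variables $p^k$ (the copies), $\mathsf r^k_p$, $\mathsf w^k_p$ for $p\in\mathbb P$, $k\in\{1,2\}$. For a program $\pi$ over $\mathbb P$, let $\pi^k$ be $\pi$ with each variable $p$ replaced by $p^k$. Write $\mathsf W(x)=\langle +_Vx\rangle\top$, $\mathsf R(x)=\langle x?\!?\rangle\top\lor\langle\lnot x?\!?\rangle\top$ and $x\leftarrow\varphi=(\varphi?;+_Vx)\sqcup(\lnot\varphi?;-_Vx)$. Let $P$ be a repetition-free enumeration of $\mathbb P_{\pi_1\parallel\pi_2}$, and let $\prod$ denote sequential composition (the empty one is $\top?$), over $p$ in the order of $P$ and over $k$ in the order $1,2$. Put $$\mathrm{split}(P)=\prod_{p\in P}\Big(+_Wp^1;+_Wp^2;\big((p?;+_Vp^1;+_Vp^2)\sqcup(\lnot p?;-_Vp^1;-_Vp^2)\big);-_Rp^1;-_Rp^2;\sigma_p\Big),$$ $$\sigma_p=\lnot\mathsf R(p)?\ \sqcup\ \big(\mathsf W(p)?;(+_Wp^1\sqcup +_Wp^2)\big)\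 \sqcup\ \big((\lnot\mathsf W(p)\land\mathsf R(p))?;(+_Rp^1\sqcup +_Rp^2\sqcup(+_Rp^1;+_Rp^2))\big),$$ $$\mathrm{store}(P)=\prod_{p\in P}\prod_{k}\big(+_W\mathsf r^k_p;+_W\mathsf w^k_p;(\mathsf r^k_p\leftarrow\mathsf R(p^k));(\mathsf w^k_p\leftarrow\mathsf W(p^k))\big),$$ $$\mathrm{ok}(P)=\bigwedge_{p\in P}\bigwedge_{k}\big((\mathsf r^k_p\leftrightarrow\mathsf R(p^k))\land(\mathsf w^k_p\leftrightarrow\mathsf W(p^k))\land(\lnot\mathsf w^k_p\to(p\leftrightarrow p^k))\big),$$ $$\mathrm{merge}(P)=\prod_{p\in P}\Big(\mu_p;\prod_k\big(-_V\mathsf r^k_p;-_V\mathsf w^k_p;+_Wp^k;-_Vp^k;-_R\mathsf r^k_p;-_R\mathsf w^k_p;-_Rp^k\big)\Big),$$ $$\mu_p=\lnot\mathsf W(p)?\ \sqcup\ \Big(\big((\mathsf W(p^1)\land p^1)\lor(\mathsf W(p^2)\land p^2)\big)?;+_Vp\Big)\ \sqcup\ \Big(\big((\mathsf W(p^1)\land\lnot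 p^1)\lor(\mathsf W(p^2)\land\lnot p^2)\big)?;-_Vp\Big),$$ $$\mathrm{flatten}(\pi_1,\pi_2)=\mathrm{split}(P);\mathrm{store}(P);\pi_1^1;\pi_2^2;\mathrm{ok}(P)?;\mathrm{merge}(P).$$ A model over $\mathbb P$ is regarded as a model over $\mathbb P^+$ in which all fresh variables are unreadable, non-writable and false. **Lemma.** For all programs $\pi_1,\pi_2$ over $\mathbb P$, every repetition-free enumeration $P$ of $\mathbb P_{\pi_1\parallel\pi_2}$ and all models $m,m'$ over $\mathbb P$, $$m\,[\![\pi_1\parallel\pi_2]\!]\,m'\quad\text{if and only if}\quad m\,[\![\mathrm{flatten}(\pi_1,\pi_2)]\!]\,m'.$$ Moreover, every model over $\mathbb P^+$ to which $\mathrm{flatten}(\pi_1,\pi_2)$ relates a model $m$ over $\mathbb P$ is itself (regarded as above) a model over $\mathbb P$. -/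

import Mathlib

namespace DLPA

universe u

/-! ### Models, split and merge -/

/-- A model (system state) over the propositional variables `α`: the sets `R` of readable,
`W` of writable and `V` of true variables, where writability implies readability. -/
@[ext]
structure Model (α : Type*) where
  R : Set α
  W : Set α
  V : Set α
  W_sub_R : W ⊆ R

namespace Model

variable {α : Type*}

def RWDisjoint (M₁ M₂ : Model α) : Prop :=
  M₁.W ∩ M₂.R = ∅ ∧ M₂.W ∩ M₁.R = ∅

def Split (M M₁ M₂ : Model α) : Prop :=
  RWDisjoint M₁ M₂ ∧ M.R = M₁.R ∪ M₂.R ∧ M.W = M₁.W ∪ M₂.W ∧ M.V = M₁.V ∧ M.V = M₂.V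

def Merge (M M₁ M₂ : Model α) : Prop :=
  RWDisjoint M₁ M₂ ∧ M.R = M₁.R ∪ M₂.R ∧ M.W = M₁.W ∪ M₂.W ∧
    M₁.V \ M.W = M₂.V \ M.W ∧
    M.V = (M₁.V ∩ M₁.W) ∪ (M₂.V ∩ M₂.W) ∪ (M₁.V ∩ M₂.V)

/-- Read-indistinguishability `M ∼ M'`. -/
def Indist (M M' : Model α) : Prop :=
  M.R = M'.R ∧ M.W = M'.W ∧ M.V ∩ M.R = M'.V ∩ M'.R

/-- The run from `M` to `M'` is legal: readability and writability are unchanged, and the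
truth values of non-writable variables are unchanged. -/
def LegalChange (M M' : Model α) : Prop :=
  M.R = M'.R ∧ M.W = M'.W ∧ M.V \ M.W = M'.V \ M'.W

end Model

/-! ### Language -/

mutual

inductive Formula (α : Type u) : Type u where
  | var (p : α) : Formula α
  | top : Formula α
  | neg (φ : Formula α) : Formula α
  | or (φ ψ : Formula α) : Formula α
  | dia (π : Program α) (φ : Formula α) : Formula α

inductive Program (α : Type u) : Type u where
  /-- make `p` true -/
  | setV (p : α) : Program α
  /-- make `p` false -/
  | unsetV (p : α) : Program α
  /-- make `p` readable -/
  | setR (p : α) : Program α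
  /-- make `p` unreadable -/
  | unsetR (p : α) : Program α
  /-- make `p` writable -/
  | setW (p : α) : Program α
  /-- make `p` non-writable -/
  | unsetW (p : α) : Program α
  /-- the exogenous test (the test of propositional dynamic logic) -/
  | test (φ : Formula α) : Program α
  /-- the endogenous test -/
  | endoTest (φ : Formula α) : Program α
  | seq (π₁ π₂ : Program α) : Program α
  | choice (π₁ π₂ : Program α) : Program α
  | star (π : Program α) : Program α
  | par (π₁ π₂ : Program α) : Program α

end

/-! ### Semantics -/

/-- The `n`-th power of a binary relation. -/
def relPow {β : Type*} (r : β → β → Prop) : ℕ → β → β → Prop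
  | 0 => fun x y => x = y
  | n + 1 => fun x y => ∃ z, r x z ∧ relPow r n z y

mutual

/-- `M ⊨ φ` -/
def Formula.Sat {α : Type*} : Formula α → Model α → Prop
  | .var p, M => p ∈ M.V
  | .top, _ => True
  | .neg φ, M => ¬ φ.Sat M
  | .or φ ψ, M => φ.Sat M ∨ ψ.Sat M
  | .dia π φ, M => ∃ M', π.Rel M M' ∧ φ.Sat M'

/-- `π.Rel M M'`: the program `π` relates the model `M` to the model `M'`. -/
def Program.Rel {α : Type*} : Program α → Model α → Model α → Prop
  | .setV p, M, M' => M'.R = M.R ∧ M'.W = M.W ∧ M'.V = M.V ∪ {p} ∧ p ∈ M.W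
  | .unsetV p, M, M' => M'.R = M.R ∧ M'.W = M.W ∧ M'.V = M.V \ {p} ∧ p ∈ M.W
  | .setR p, M, M' => M'.R = M.R ∪ {p} ∧ M'.W = M.W ∧ M'.V = M.V
  | .unsetR p, M, M' => M'.R = M.R \ {p} ∧ M'.W = M.W \ {p} ∧ M'.V = M.V
  | .setW p, M, M' => M'.R = M.R ∪ {p} ∧ M'.W = M.W ∪ {p} ∧ M'.V = M.V
  | .unsetW p, M, M' => M'.R = M.R ∧ M'.W = M.W \ {p} ∧ M'.V = M.V
  | .test φ, M, M' => M = M' ∧ φ.Sat M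
  | .endoTest φ, M, M' => M = M' ∧ ∀ M'', Model.Indist M'' M → φ.Sat M''
  | .seq π₁ π₂, M, M' => ∃ M'', π₁.Rel M M'' ∧ π₂.Rel M'' M'
  | .choice π₁ π₂, M, M' => π₁.Rel M M' ∨ π₂.Rel M M'
  | .star π, M, M' => ∃ n : ℕ, relPow (fun N N' => π.Rel N N') n M M'
  | .par π₁ π₂, M, M' => ∃ M₁ M₂ M₁' M₂' : Model α,
      Model.Split M M₁ M₂ ∧ Model.Merge M' M₁' M₂' ∧
      π₁.Rel M₁ M₁' ∧ Model.LegalChange M₁ M₁' ∧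
      π₂.Rel M₂ M₂' ∧ Model.LegalChange M₂ M₂'

end

/-! ### Occurring variables and renaming -/

mutual

/-- The set of propositional variables occurring in a formula. -/
def Formula.vars {α : Type*} [DecidableEq α] : Formula α → Finset α
  | .var p => {p}
  | .top => ∅
  | .neg φ => φ.vars
  | .or φ ψ => φ.vars ∪ ψ.vars
  | .dia π φ => π.vars ∪ φ.vars

/-- The set of propositional variables occurring in a program. -/
def Program.vars {α : Type*} [DecidableEq α] : Program α → Finset α
  | .setV p => {p}
  | .unsetV p => {p}
  | .setR p => {p}
  | .unsetR p => {p}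
  | .setW p => {p}
  | .unsetW p => {p}
  | .test φ => φ.vars
  | .endoTest φ => φ.vars
  | .seq π₁ π₂ => π₁.vars ∪ π₂.vars
  | .choice π₁ π₂ => π₁.vars ∪ π₂.vars
  | .star π => π.vars
  | .par π₁ π₂ => π₁.vars ∪ π₂.vars

end

mutual

/-- Replace every occurrence of every variable `p` by `f p`. -/
def Formula.map {α β : Type*} (f : α → β) : Formula α → Formula β
  | .var p => .var (f p)
  | .top => .top
  | .neg φ => .neg (φ.map f)
  | .or φ ψ => .or (φ.map f) (ψ.map f)
  | .dia π φ => .dia (π.map f) (φ.map f)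

/-- Replace every occurrence of every variable `p` by `f p`. -/
def Program.map {α β : Type*} (f : α → β) : Program α → Program β
  | .setV p => .setV (f p)
  | .unsetV p => .unsetV (f p)
  | .setR p => .setR (f p)
  | .unsetR p => .unsetR (f p)
  | .setW p => .setW (f p)
  | .unsetW p => .unsetW (f p)
  | .test φ => .test (φ.map f)
  | .endoTest φ => .endoTest (φ.map f)
  | .seq π₁ π₂ => .seq (π₁.map f) (π₂.map f)
  | .choice π₁ π₂ => .choice (π₁.map f) (π₂.map f)
  | .star π => .star (π.map f)
  | .par π₁ π₂ => .par (π₁.map f) (π₂.map f)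

end

/-! ### Abbreviations -/

namespace Formula

variable {α : Type*}

def and (φ ψ : Formula α) : Formula α := neg (or (neg φ) (neg ψ))

def imp (φ ψ : Formula α) : Formula α := or (neg φ) ψ

def iff (φ ψ : Formula α) : Formula α := and (imp φ ψ) (imp ψ φ)

/-- Finite conjunction; the empty conjunction is `⊤`. -/
def bigAnd : List (Formula α) → Formula α
  | [] => top
  | [φ] => φ
  | φ :: ψ :: l => and φ (bigAnd (ψ :: l))

/-- `p` is writable. -/
def writable (p : α) : Formula α := dia (.setV p) top

/-- `p` is readable. -/
def readable (p : α) : Formula α :=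
  or (dia (.endoTest (var p)) top) (dia (.endoTest (neg (var p))) top)

end Formula

namespace Program

variable {α : Type*}

/-- Sequential composition of a list of programs; the empty sequence is `⊤?`. -/
def seqList : List (Program α) → Program α
  | [] => test .top
  | [π] => π
  | π :: π' :: l => seq π (seqList (π' :: l))

/-- The assignment to `p` of the truth value of `φ`. -/
def assign (p : α) (φ : Formula α) : Program α :=
  choice (seq (test φ) (setV p)) (seq (test (.neg φ)) (unsetV p))

end Program

/-! ### Fresh copies of variables -/

/-- The two indices of copies. -/
inductive Side where
  | one
  | two

/-- The variables `α` together with pairwise distinct fresh variables: for each `p` and each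
`k`, the copy of `p`, and the two variables that store whether this copy was readable,
respectively writable, just after the split. -/
inductive ExtVar (α : Type*) where
  | base (p : α)
  | copy (k : Side) (p : α)
  | rd (k : Side) (p : α)
  | wr (k : Side) (p : α)

/-- A model over `α`, seen as a model over the extended set of variables: the fresh variables
are unreadable, non-writable and false. -/
def Model.extend {α : Type*} (M : Model α) : Model (ExtVar α) where
  R := ExtVar.base '' M.R
  W := ExtVar.base '' M.W
  V := ExtVar.base '' M.V
  W_sub_R := Set.image_mono M.W_sub_R

/-! ### The flattening program

A finite set `P` of variables is given by a list that enumerates it. -/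

section Flatten

variable {α : Type*}

open Formula Program ExtVar

def splitAt (p : α) : Program (ExtVar α) :=
  seqList [
    setW (copy .one p), setW (copy .two p),
    choice
      (seqList [test (var (base p)), setV (copy .one p), setV (copy .two p)])
      (seqList [test (neg (var (base p))), unsetV (copy .one p), unsetV (copy .two p)]),
    unsetR (copy .one p), unsetR (copy .two p),
    choice (test (neg (readable (base p))))
      (choice
        (seq (test (writable (base p)))
          (choice (setW (copy .one p)) (setW (copy .two p))))
        (seq (test (Formula.and (neg (writable (base p))) (readable (base p))))
          (choice (setR (copy .one p))
            (choice (setR (copy .two p))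
              (seq (setR (copy .one p)) (setR (copy .two p)))))))]

def split (P : List α) : Program (ExtVar α) :=
  seqList (P.map splitAt)

def storeAt (p : α) (k : Side) : Program (ExtVar α) :=
  seqList [
    setW (rd k p), setW (wr k p),
    assign (rd k p) (readable (copy k p)),
    assign (wr k p) (writable (copy k p))]

def store (P : List α) : Program (ExtVar α) :=
  seqList (P.map fun p => seqList ([Side.one, Side.two].map (storeAt p)))

def okChangeAt (p : α) (k : Side) : Formula (ExtVar α) :=
  Formula.and (Formula.iff (var (rd k p)) (readable (copy k p)))
    (Formula.and (Formula.iff (var (wr k p)) (writable (copy k p)))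
      (imp (neg (var (wr k p))) (Formula.iff (var (base p)) (var (copy k p)))))

def okChange (P : List α) : Formula (ExtVar α) :=
  bigAnd (P.map fun p => bigAnd ([Side.one, Side.two].map (okChangeAt p)))

def cleanAt (p : α) (k : Side) : Program (ExtVar α) :=
  seqList [
    unsetV (rd k p), unsetV (wr k p), setW (copy k p), unsetV (copy k p),
    unsetR (rd k p), unsetR (wr k p), unsetR (copy k p)]

def mergeAt (p : α) : Program (ExtVar α) :=
  seq
    (choice (test (neg (writable (base p))))
      (choice
        (seq
          (test (Formula.or
            (Formula.and (writable (copy .one p)) (var (copy .one p)))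
            (Formula.and (writable (copy .two p)) (var (copy .two p)))))
          (setV (base p)))
        (seq
          (test (Formula.or
            (Formula.and (writable (copy .one p)) (neg (var (copy .one p))))
            (Formula.and (writable (copy .two p)) (neg (var (copy .two p))))))
          (unsetV (base p)))))
    (seqList ([Side.one, Side.two].map (cleanAt p)))

def merge (P : List α) : Program (ExtVar α) :=
  seqList (P.map mergeAt)

/-- The flattening of `π₁ ∥ π₂`, where `P` enumerates the variables occurring in `π₁ ∥ π₂`. -/
def flatten (P : List α) (π₁ π₂ : Program α) : Program (ExtVar α) :=
  seqList [
    split P,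
    store P,
    π₁.map (copy .one),
    π₂.map (copy .two),
    test (okChange P),
    merge P]

end Flatten

end DLPA

namespace DLPA

universe u v

namespace Model

variable {β γ : Type*}

/-- `p` has the same status (readability, writability, truth value) in `M` as `q` in `N`. -/
def Agree (M : Model β) (p : β) (N : Model γ) (q : γ) : Prop :=
  (p ∈ M.R ↔ q ∈ N.R) ∧ (p ∈ M.W ↔ q ∈ N.W) ∧ (p ∈ M.V ↔ q ∈ N.V)

theorem Agree.refl (M : Model β) (p : β) : Agree M p M p := ⟨.rfl, .rfl, .rfl⟩

theorem Agree.symm {M : Model β} {N : Model γ} {p : β} {q : γ} (h : Agree M p N q) :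
    Agree N q M p := ⟨h.1.symm, h.2.1.symm, h.2.2.symm⟩

theorem Agree.trans {δ : Type*} {M : Model β} {N : Model γ} {K : Model δ} {p : β} {q : γ} {r : δ}
    (h : Agree M p N q) (h' : Agree N q K r) : Agree M p K r :=
  ⟨h.1.trans h'.1, h.2.1.trans h'.2.1, h.2.2.trans h'.2.2⟩

theorem eq_iff_agree {M N : Model β} : M = N ↔ ∀ q, Agree M q N q := by
  refine ⟨fun h q => h ▸ Agree.refl M q, fun h => ?_⟩
  ext q
  · exact (h q).1
  · exact (h q).2.1
  · exact (h q).2.2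

theorem split_iff {M M₁ M₂ : Model β} : Split M M₁ M₂ ↔ ∀ q,
    ¬ (q ∈ M₁.W ∧ q ∈ M₂.R) ∧ ¬ (q ∈ M₂.W ∧ q ∈ M₁.R) ∧ (q ∈ M.R ↔ q ∈ M₁.R ∨ q ∈ M₂.R) ∧
    (q ∈ M.W ↔ q ∈ M₁.W ∨ q ∈ M₂.W) ∧ (q ∈ M.V ↔ q ∈ M₁.V) ∧ (q ∈ M.V ↔ q ∈ M₂.V) := by
  simp only [Split, RWDisjoint, Set.ext_iff, Set.mem_inter_iff, Set.mem_empty_iff_false, iff_false,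
    Set.mem_union, forall_and]
  tauto

theorem merge_iff {M M₁ M₂ : Model β} : Merge M M₁ M₂ ↔ ∀ q,
    ¬ (q ∈ M₁.W ∧ q ∈ M₂.R) ∧ ¬ (q ∈ M₂.W ∧ q ∈ M₁.R) ∧ (q ∈ M.R ↔ q ∈ M₁.R ∨ q ∈ M₂.R) ∧
    (q ∈ M.W ↔ q ∈ M₁.W ∨ q ∈ M₂.W) ∧ (q ∈ M₁.V ∧ q ∉ M.W ↔ q ∈ M₂.V ∧ q ∉ M.W) ∧
    (q ∈ M.V ↔ ((q ∈ M₁.V ∧ q ∈ M₁.W) ∨ (q ∈ M₂.V ∧ q ∈ M₂.W)) ∨ (q ∈ M₁.V ∧ q ∈ M₂.V)) := by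
  simp only [Merge, RWDisjoint, Set.ext_iff, Set.mem_inter_iff, Set.mem_empty_iff_false, iff_false,
    Set.mem_union, Set.mem_sdiff, forall_and]
  tauto

theorem legalChange_iff {M N : Model β} : LegalChange M N ↔ ∀ q,
    (q ∈ M.R ↔ q ∈ N.R) ∧ (q ∈ M.W ↔ q ∈ N.W) ∧ (q ∈ M.V ∧ q ∉ M.W ↔ q ∈ N.V ∧ q ∉ N.W) := by
  simp only [LegalChange, Set.ext_iff, Set.mem_sdiff, forall_and]

theorem indist_iff {M N : Model β} : Indist M N ↔ ∀ q,
    (q ∈ M.R ↔ q ∈ N.R) ∧ (q ∈ M.W ↔ q ∈ N.W) ∧ (q ∈ M.V ∧ q ∈ M.R ↔ q ∈ N.V ∧ q ∈ N.R) := by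
  simp only [Indist, Set.ext_iff, Set.mem_inter_iff, forall_and]

/-! ### Elementary updates -/

def addV (M : Model β) (p : β) : Model β := ⟨M.R, M.W, M.V ∪ {p}, M.W_sub_R⟩

def delV (M : Model β) (p : β) : Model β := ⟨M.R, M.W, M.V \ {p}, M.W_sub_R⟩

def addR (M : Model β) (p : β) : Model β :=
  ⟨M.R ∪ {p}, M.W, M.V, M.W_sub_R.trans Set.subset_union_left⟩

def delR (M : Model β) (p : β) : Model β :=
  ⟨M.R \ {p}, M.W \ {p}, M.V, Set.sdiff_subset_sdiff_left M.W_sub_R⟩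

def addW (M : Model β) (p : β) : Model β :=
  ⟨M.R ∪ {p}, M.W ∪ {p}, M.V, Set.union_subset_union_left _ M.W_sub_R⟩

def delW (M : Model β) (p : β) : Model β :=
  ⟨M.R, M.W \ {p}, M.V, Set.sdiff_subset.trans M.W_sub_R⟩

/-- The model over `γ` which on `g s`, for `s ∈ S`, is like `M` on `f s`, and elsewhere like
`N`. -/
def patch {α : Type*} (S : Set α) (f : α → β) (g : α → γ) (M : Model β) (N : Model γ) :
    Model γ where
  R := {q | (∃ s ∈ S, g s = q ∧ f s ∈ M.R) ∨ (q ∉ g '' S ∧ q ∈ N.R)}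
  W := {q | (∃ s ∈ S, g s = q ∧ f s ∈ M.W) ∨ (q ∉ g '' S ∧ q ∈ N.W)}
  V := {q | (∃ s ∈ S, g s = q ∧ f s ∈ M.V) ∨ (q ∉ g '' S ∧ q ∈ N.V)}
  W_sub_R := by
    rintro q (⟨s, hs, h, h'⟩ | ⟨h, h'⟩)
    · exact .inl ⟨s, hs, h, M.W_sub_R h'⟩
    · exact .inr ⟨h, N.W_sub_R h'⟩

section

variable {α : Type*} {S : Set α} {f : α → β} {g : α → γ}

theorem agree_patch_of_mem (hg : S.InjOn g) (M : Model β) (N : Model γ) {s : α} (hs : s ∈ S) :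
    Agree M (f s) (patch S f g M N) (g s) := by
  have key : ∀ X : Set β, ∀ Y : Set γ, (f s ∈ X ↔
      (∃ t ∈ S, g t = g s ∧ f t ∈ X) ∨ (g s ∉ g '' S ∧ g s ∈ Y)) := by
    intro X Y
    constructor
    · exact fun h => .inl ⟨s, hs, rfl, h⟩
    · rintro (⟨t, ht, e, h⟩ | ⟨h, -⟩)
      · exact hg ht hs e ▸ h
      · exact absurd ⟨s, hs, rfl⟩ h
  exact ⟨key _ _, key _ _, key _ _⟩

theorem agree_patch_of_notMem (M : Model β) (N : Model γ) {q : γ} (hq : q ∉ g '' S) :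
    Agree N q (patch S f g M N) q := by
  have key : ∀ X : Set β, ∀ Y : Set γ, (q ∈ Y ↔
      (∃ t ∈ S, g t = q ∧ f t ∈ X) ∨ (q ∉ g '' S ∧ q ∈ Y)) := by
    intro X Y
    constructor
    · exact fun h => .inr ⟨hq, h⟩
    · rintro (⟨t, ht, e, -⟩ | ⟨-, h⟩)
      · exact absurd ⟨t, ht, e⟩ hq
      · exact h
  exact ⟨key _ _, key _ _, key _ _⟩

end

end Model

open Model

section Primitives

variable {β : Type*} {M N : Model β} {p : β}

theorem Program.rel_setV : (Program.setV p).Rel M N ↔ p ∈ M.W ∧ N = M.addV p := by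
  simp only [Program.Rel, Model.ext_iff, addV]; tauto

theorem Program.rel_unsetV : (Program.unsetV p).Rel M N ↔ p ∈ M.W ∧ N = M.delV p := by
  simp only [Program.Rel, Model.ext_iff, delV]; tauto

theorem Program.rel_setR : (Program.setR p).Rel M N ↔ N = M.addR p := by
  simp only [Program.Rel, Model.ext_iff, addR]

theorem Program.rel_unsetR : (Program.unsetR p).Rel M N ↔ N = M.delR p := by
  simp only [Program.Rel, Model.ext_iff, delR]

theorem Program.rel_setW : (Program.setW p).Rel M N ↔ N = M.addW p := by
  simp only [Program.Rel, Model.ext_iff, addW]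

theorem Program.rel_unsetW : (Program.unsetW p).Rel M N ↔ N = M.delW p := by
  simp only [Program.Rel, Model.ext_iff, delW]

end Primitives

/-! ### Locality -/

section Frame

variable {α : Type*} [DecidableEq α] {β : Type*} (f : α → β) (S : Set α)

theorem Program.agree_of_rel_map : ∀ (π : Program α), (π.vars : Set α) ⊆ S →
    ∀ (M M' : Model β), (π.map f).Rel M M' → ∀ q ∉ f '' S, Agree M q M' q
  | .setV p, hS, M, M', h, q, hq => by
    have : q ≠ f p := fun e => hq ⟨p, hS (by simp [Program.vars]), e.symm⟩
    rw [Program.map, Program.rel_setV] at h; simp [h.2, addV, Agree, this]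
  | .unsetV p, hS, M, M', h, q, hq => by
    have : q ≠ f p := fun e => hq ⟨p, hS (by simp [Program.vars]), e.symm⟩
    rw [Program.map, Program.rel_unsetV] at h; simp [h.2, delV, Agree, this]
  | .setR p, hS, M, M', h, q, hq => by
    have : q ≠ f p := fun e => hq ⟨p, hS (by simp [Program.vars]), e.symm⟩
    rw [Program.map, Program.rel_setR] at h; simp [h, addR, Agree, this]
  | .unsetR p, hS, M, M', h, q, hq => by
    have : q ≠ f p := fun e => hq ⟨p, hS (by simp [Program.vars]), e.symm⟩
    rw [Program.map, Program.rel_unsetR] at h; simp [h, delR, Agree, this]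
  | .setW p, hS, M, M', h, q, hq => by
    have : q ≠ f p := fun e => hq ⟨p, hS (by simp [Program.vars]), e.symm⟩
    rw [Program.map, Program.rel_setW] at h; simp [h, addW, Agree, this]
  | .unsetW p, hS, M, M', h, q, hq => by
    have : q ≠ f p := fun e => hq ⟨p, hS (by simp [Program.vars]), e.symm⟩
    rw [Program.map, Program.rel_unsetW] at h; simp [h, delW, Agree, this]
  | .test φ, _, M, M', h, q, _ => by
    simp only [Program.map, Program.Rel] at h; exact h.1 ▸ Agree.refl M q
  | .endoTest φ, _, M, M', h, q, _ => by
    simp only [Program.map, Program.Rel] at h; exact h.1 ▸ Agree.refl M q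
  | .seq π₁ π₂, hS, M, M', h, q, hq => by
    simp only [Program.map, Program.Rel] at h
    simp only [Program.vars, Finset.coe_union, Set.union_subset_iff] at hS
    obtain ⟨K, h₁, h₂⟩ := h
    exact (agree_of_rel_map π₁ hS.1 _ _ h₁ q hq).trans (agree_of_rel_map π₂ hS.2 _ _ h₂ q hq)
  | .choice π₁ π₂, hS, M, M', h, q, hq => by
    simp only [Program.map, Program.Rel] at h
    simp only [Program.vars, Finset.coe_union, Set.union_subset_iff] at hS
    exact h.elim (fun h => agree_of_rel_map π₁ hS.1 _ _ h q hq)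
      (fun h => agree_of_rel_map π₂ hS.2 _ _ h q hq)
  | .star π, hS, M, M', h, q, hq => by
    simp only [Program.map, Program.Rel] at h
    simp only [Program.vars] at hS
    obtain ⟨n, h⟩ := h
    induction n generalizing M with
    | zero => exact h ▸ Agree.refl M q
    | succ n ih =>
      obtain ⟨K, h₁, h₂⟩ := h
      exact (agree_of_rel_map π hS _ _ h₁ q hq).trans (ih K h₂)
  | .par π₁ π₂, hS, M, M', h, q, hq => by
    simp only [Program.map, Program.Rel] at h
    simp only [Program.vars, Finset.coe_union, Set.union_subset_iff] at hS
    obtain ⟨M₁, M₂, M₁', M₂', hs, hm, h₁, -, h₂, -⟩ := h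
    have a₁ := agree_of_rel_map π₁ hS.1 _ _ h₁ q hq
    have a₂ := agree_of_rel_map π₂ hS.2 _ _ h₂ q hq
    have hs := split_iff.1 hs q
    have hm := merge_iff.1 hm q
    unfold Agree at *
    grind

end Frame

section Simulation

variable {α : Type u} (S : Set α)

/-- `M` and `N` agree on the variables in `S`, renamed along `f` and `g` respectively. -/
def AgreeOn {β γ : Type*} (f : α → β) (g : α → γ) (M : Model β) (N : Model γ) : Prop :=
  ∀ s ∈ S, Agree M (f s) N (g s)

variable {S}

theorem AgreeOn.symm {β γ : Type*} {f : α → β} {g : α → γ} {M : Model β} {N : Model γ}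
    (h : AgreeOn S f g M N) : AgreeOn S g f N M := fun s hs => (h s hs).symm

theorem exists_update {β γ : Type*} {f : α → β} {g : α → γ} (hg : S.InjOn g)
    (M' : Model β) (N : Model γ) :
    ∃ N', AgreeOn S f g M' N' ∧ ∀ q ∉ g '' S, Agree N q N' q :=
  ⟨patch S f g M' N, fun _ hs => agree_patch_of_mem hg _ _ hs,
    fun _ hq => agree_patch_of_notMem _ _ hq⟩

theorem AgreeOn.update {β γ : Type v} {f : α → β} {g : α → γ} (hf : S.InjOn f)
    (hg : S.InjOn g) {M : Model β} {N : Model γ} (h : AgreeOn S f g M N) {p : α} (hp : p ∈ S)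
    {u₁ : Model β → β → Model β} {u₂ : Model γ → γ → Model γ}
    (hu₁ : ∀ t ∈ S, f t ≠ f p → Agree M (f t) (u₁ M (f p)) (f t))
    (hu₂ : ∀ q ≠ g p, Agree N q (u₂ N (g p)) q)
    (hp' : Agree M (f p) N (g p) → Agree (u₁ M (f p)) (f p) (u₂ N (g p)) (g p)) :
    AgreeOn S f g (u₁ M (f p)) (u₂ N (g p)) ∧ ∀ q ∉ g '' S, Agree N q (u₂ N (g p)) q := by
  refine ⟨fun t ht => ?_, fun q hq => hu₂ q fun e => hq ⟨p, hp, e.symm⟩⟩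
  by_cases e : t = p
  · exact e ▸ hp' (h p hp)
  · exact ((hu₁ t ht fun e' => e (hf ht hp e')).symm.trans (h t ht)).trans
      (hu₂ _ fun e' => e (hg ht hp e'))

variable [DecidableEq α]

mutual

theorem Formula.sat_map_of_agreeOn : ∀ (φ : Formula α), (φ.vars : Set α) ⊆ S →
    ∀ {β γ : Type v} {f : α → β} {g : α → γ}, S.InjOn f → S.InjOn g →
    ∀ {M : Model β} {N : Model γ}, AgreeOn S f g M N → (φ.map f).Sat M → (φ.map g).Sat N
  | .var p, hS, _, _, f, g, _, _, M, N, h, hs => by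
    simp only [Formula.map, Formula.Sat] at hs ⊢
    exact (h p (hS (by simp [Formula.vars]))).2.2.1 hs
  | .top, _, _, _, _, _, _, _, _, _, _, _ => by simp only [Formula.map, Formula.Sat]
  | .neg φ, hS, _, _, f, g, hf, hg, M, N, h, hs => by
    simp only [Formula.map, Formula.Sat, Formula.vars] at hs hS ⊢
    exact fun h' => hs (Formula.sat_map_of_agreeOn φ hS hg hf h.symm h')
  | .or φ ψ, hS, _, _, f, g, hf, hg, M, N, h, hs => by
    simp only [Formula.map, Formula.Sat] at hs ⊢
    simp only [Formula.vars, Finset.coe_union, Set.union_subset_iff] at hS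
    exact hs.imp (Formula.sat_map_of_agreeOn φ hS.1 hf hg h)
      (Formula.sat_map_of_agreeOn ψ hS.2 hf hg h)
  | .dia π φ, hS, _, _, f, g, hf, hg, M, N, h, hs => by
    simp only [Formula.map, Formula.Sat] at hs ⊢
    simp only [Formula.vars, Finset.coe_union, Set.union_subset_iff] at hS
    obtain ⟨M', hr, hs⟩ := hs
    obtain ⟨N', hr', h', -⟩ := Program.exists_rel_map_of_agreeOn π hS.1 hf hg h hr
    exact ⟨N', hr', Formula.sat_map_of_agreeOn φ hS.2 hf hg h' hs⟩

theorem Program.exists_rel_map_of_agreeOn : ∀ (π : Program α), (π.vars : Set α) ⊆ S →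
    ∀ {β γ : Type v} {f : α → β} {g : α → γ}, S.InjOn f → S.InjOn g →
    ∀ {M M' : Model β} {N : Model γ}, AgreeOn S f g M N → (π.map f).Rel M M' →
    ∃ N', (π.map g).Rel N N' ∧ AgreeOn S f g M' N' ∧ ∀ q ∉ g '' S, Agree N q N' q
  | .setV p, hS, _, _, f, g, hf, hg, M, M', N, h, hr => by
    have hp : p ∈ S := hS (by simp [Program.vars])
    simp only [Program.map, Program.rel_setV] at hr ⊢
    obtain ⟨hw, rfl⟩ := hr
    refine ⟨_, ⟨(h p hp).2.1.1 hw, rfl⟩, ?_⟩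
    apply AgreeOn.update hf hg h hp <;> simp +contextual [addV, Agree]
  | .unsetV p, hS, _, _, f, g, hf, hg, M, M', N, h, hr => by
    have hp : p ∈ S := hS (by simp [Program.vars])
    simp only [Program.map, Program.rel_unsetV] at hr ⊢
    obtain ⟨hw, rfl⟩ := hr
    refine ⟨_, ⟨(h p hp).2.1.1 hw, rfl⟩, ?_⟩
    apply AgreeOn.update hf hg h hp <;> simp +contextual [delV, Agree]
  | .setR p, hS, _, _, f, g, hf, hg, M, M', N, h, hr => by
    have hp : p ∈ S := hS (by simp [Program.vars])
    simp only [Program.map, Program.rel_setR] at hr ⊢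
    subst hr
    refine ⟨_, rfl, ?_⟩
    apply AgreeOn.update hf hg h hp <;> simp +contextual [addR, Agree]
  | .unsetR p, hS, _, _, f, g, hf, hg, M, M', N, h, hr => by
    have hp : p ∈ S := hS (by simp [Program.vars])
    simp only [Program.map, Program.rel_unsetR] at hr ⊢
    subst hr
    refine ⟨_, rfl, ?_⟩
    apply AgreeOn.update hf hg h hp <;> simp +contextual [delR, Agree]
  | .setW p, hS, _, _, f, g, hf, hg, M, M', N, h, hr => by
    have hp : p ∈ S := hS (by simp [Program.vars])
    simp only [Program.map, Program.rel_setW] at hr ⊢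
    subst hr
    refine ⟨_, rfl, ?_⟩
    apply AgreeOn.update hf hg h hp <;> simp +contextual [addW, Agree]
  | .unsetW p, hS, _, _, f, g, hf, hg, M, M', N, h, hr => by
    have hp : p ∈ S := hS (by simp [Program.vars])
    simp only [Program.map, Program.rel_unsetW] at hr ⊢
    subst hr
    refine ⟨_, rfl, ?_⟩
    apply AgreeOn.update hf hg h hp <;> simp +contextual [delW, Agree]
  | .test φ, hS, _, _, f, g, hf, hg, M, M', N, h, hr => by
    simp only [Program.map, Program.Rel, Program.vars] at hr hS ⊢
    obtain ⟨rfl, hr⟩ := hr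
    exact ⟨N, ⟨rfl, Formula.sat_map_of_agreeOn φ hS hf hg h hr⟩, h, fun q _ => Agree.refl N q⟩
  | .endoTest φ, hS, _, _, f, g, hf, hg, M, M', N, h, hr => by
    simp only [Program.map, Program.Rel, Program.vars] at hr hS ⊢
    obtain ⟨rfl, hr⟩ := hr
    refine ⟨N, ⟨rfl, fun N'' hN => ?_⟩, h, fun q _ => Agree.refl N q⟩
    obtain ⟨M'', h'', hM⟩ := exists_update (f := g) hf N'' M
    refine Formula.sat_map_of_agreeOn φ hS hf hg h''.symm (hr M'' ?_)
    rw [indist_iff] at hN ⊢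
    intro q
    by_cases hq : q ∈ f '' S
    · obtain ⟨s, hs, rfl⟩ := hq
      have h₁ := h s hs
      have h₂ := h'' s hs
      have h₃ := hN (g s)
      unfold Agree at h₁ h₂
      grind
    · have := hM q hq
      unfold Agree at this
      grind
  | .seq π₁ π₂, hS, _, _, f, g, hf, hg, M, M', N, h, hr => by
    simp only [Program.map, Program.Rel] at hr ⊢
    simp only [Program.vars, Finset.coe_union, Set.union_subset_iff] at hS
    obtain ⟨K, h₁, h₂⟩ := hr
    obtain ⟨L, r₁, a₁, o₁⟩ := Program.exists_rel_map_of_agreeOn π₁ hS.1 hf hg h h₁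
    obtain ⟨N', r₂, a₂, o₂⟩ := Program.exists_rel_map_of_agreeOn π₂ hS.2 hf hg a₁ h₂
    exact ⟨N', ⟨L, r₁, r₂⟩, a₂, fun q hq => (o₁ q hq).trans (o₂ q hq)⟩
  | .choice π₁ π₂, hS, _, _, f, g, hf, hg, M, M', N, h, hr => by
    simp only [Program.map, Program.Rel] at hr ⊢
    simp only [Program.vars, Finset.coe_union, Set.union_subset_iff] at hS
    obtain hr | hr := hr
    · obtain ⟨N', r, a⟩ := Program.exists_rel_map_of_agreeOn π₁ hS.1 hf hg h hr
      exact ⟨N', .inl r, a⟩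
    · obtain ⟨N', r, a⟩ := Program.exists_rel_map_of_agreeOn π₂ hS.2 hf hg h hr
      exact ⟨N', .inr r, a⟩
  | .star π, hS, _, _, f, g, hf, hg, M, M', N, h, hr => by
    simp only [Program.map, Program.Rel, Program.vars] at hr hS ⊢
    obtain ⟨n, hr⟩ := hr
    induction n generalizing M N with
    | zero =>
      obtain rfl : M = M' := hr
      exact ⟨N, ⟨0, rfl⟩, h, fun q _ => Agree.refl N q⟩
    | succ n ih =>
      obtain ⟨K, h₁, h₂⟩ := hr
      obtain ⟨L, r₁, a₁, o₁⟩ := Program.exists_rel_map_of_agreeOn π hS hf hg h h₁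
      obtain ⟨N', ⟨m, r₂⟩, a₂, o₂⟩ := ih (M := K) (N := L) a₁ h₂
      exact ⟨N', ⟨m + 1, L, r₁, r₂⟩, a₂, fun q hq => (o₁ q hq).trans (o₂ q hq)⟩
  | .par π₁ π₂, hS, _, _, f, g, hf, hg, M, M', N, h, hr => by
    simp only [Program.map, Program.Rel] at hr ⊢
    simp only [Program.vars, Finset.coe_union, Set.union_subset_iff] at hS
    obtain ⟨M₁, M₂, M₁', M₂', hs, hm, r₁, l₁, r₂, l₂⟩ := hr
    obtain ⟨N₁, a₁, o₁⟩ := exists_update (f := f) hg M₁ N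
    obtain ⟨N₂, a₂, o₂⟩ := exists_update (f := f) hg M₂ ⟨∅, ∅, N.V, subset_rfl⟩
    obtain ⟨N₁', r₁', a₁', o₁'⟩ := Program.exists_rel_map_of_agreeOn π₁ hS.1 hf hg a₁ r₁
    obtain ⟨N₂', r₂', a₂', o₂'⟩ := Program.exists_rel_map_of_agreeOn π₂ hS.2 hf hg a₂ r₂
    obtain ⟨N', a', o'⟩ := exists_update (f := f) hg M' N
    rw [split_iff] at hs
    rw [merge_iff] at hm
    rw [legalChange_iff] at l₁ l₂
    refine ⟨N', ⟨N₁, N₂, N₁', N₂', split_iff.2 fun q => ?_, merge_iff.2 fun q => ?_, r₁',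
      legalChange_iff.2 fun q => ?_, r₂', legalChange_iff.2 fun q => ?_⟩, a', o'⟩ <;>
    by_cases hq : q ∈ g '' S
    · obtain ⟨s, hs', rfl⟩ := hq
      have := h s hs'; have := a₁ s hs'; have := a₂ s hs'; have := hs (f s)
      unfold Agree at *
      grind
    · have := o₁ q hq; have := o₂ q hq
      simp only [Agree, Set.mem_empty_iff_false] at *
      grind
    · obtain ⟨s, hs', rfl⟩ := hq
      have := a₁' s hs'; have := a₂' s hs'; have := a' s hs'; have := hm (f s)
      simp only [Agree] at *
      grind
    · have := o₁ q hq; have := o₂ q hq; have := o₁' q hq; have := o₂' q hq; have := o' q hq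
      have := @N.W_sub_R q
      simp only [Agree, Set.mem_empty_iff_false] at *
      grind
    · obtain ⟨s, hs', rfl⟩ := hq
      have := a₁ s hs'; have := a₁' s hs'; have := l₁ (f s)
      simp only [Agree] at *
      grind
    · have := o₁' q hq
      simp only [Agree] at *
      grind
    · obtain ⟨s, hs', rfl⟩ := hq
      have := a₂ s hs'; have := a₂' s hs'; have := l₂ (f s)
      simp only [Agree] at *
      grind
    · have := o₂' q hq
      simp only [Agree] at *
      grind

end

end Simulation

mutual

theorem Formula.map_id {α : Type*} : ∀ φ : Formula α, φ.map id = φ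
  | .var p => rfl
  | .top => rfl
  | .neg φ => by rw [Formula.map, Formula.map_id φ]
  | .or φ ψ => by rw [Formula.map, Formula.map_id φ, Formula.map_id ψ]
  | .dia π φ => by rw [Formula.map, Formula.map_id φ, Program.map_id π]

theorem Program.map_id {α : Type*} : ∀ π : Program α, π.map id = π
  | .setV p => rfl
  | .unsetV p => rfl
  | .setR p => rfl
  | .unsetR p => rfl
  | .setW p => rfl
  | .unsetW p => rfl
  | .test φ => by rw [Program.map, Formula.map_id φ]
  | .endoTest φ => by rw [Program.map, Formula.map_id φ]
  | .seq π₁ π₂ => by rw [Program.map, Program.map_id π₁, Program.map_id π₂]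
  | .choice π₁ π₂ => by rw [Program.map, Program.map_id π₁, Program.map_id π₂]
  | .star π => by rw [Program.map, Program.map_id π]
  | .par π₁ π₂ => by rw [Program.map, Program.map_id π₁, Program.map_id π₂]

end

section Derived

variable {β : Type*} {M N : Model β} {p : β}

theorem Formula.sat_writable : (Formula.writable p).Sat M ↔ p ∈ M.W := by
  simp [Formula.writable, Formula.Sat, Program.rel_setV]

theorem Formula.sat_and {φ ψ : Formula β} : (Formula.and φ ψ).Sat M ↔ φ.Sat M ∧ ψ.Sat M := by
  simp only [Formula.and, Formula.Sat]; tauto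

theorem Formula.sat_imp {φ ψ : Formula β} : (Formula.imp φ ψ).Sat M ↔ (φ.Sat M → ψ.Sat M) := by
  simp only [Formula.imp, Formula.Sat]; tauto

theorem Formula.sat_iff {φ ψ : Formula β} : (Formula.iff φ ψ).Sat M ↔ (φ.Sat M ↔ ψ.Sat M) := by
  simp only [Formula.iff, Formula.sat_and, Formula.sat_imp]; tauto

theorem Formula.sat_bigAnd : ∀ {l : List (Formula β)}, (bigAnd l).Sat M ↔ ∀ φ ∈ l, φ.Sat M
  | [] => by simp [Formula.bigAnd, Formula.Sat]
  | [φ] => by simp [Formula.bigAnd]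
  | φ :: ψ :: l => by
    rw [Formula.bigAnd, Formula.sat_and, Formula.sat_bigAnd, List.forall_mem_cons (a := φ)]

theorem Formula.sat_readable : (Formula.readable p).Sat M ↔ p ∈ M.R := by
  simp only [Formula.readable, Formula.Sat, Program.Rel, and_true, exists_eq_left']
  constructor
  · intro h
    by_contra hp
    obtain h | h := h
    · have := h (M.delV p) (indist_iff.2 (fun q => by
        simp only [delV, Set.mem_sdiff, Set.mem_singleton_iff]; grind))
      simp [delV] at this
    · have := h (M.addV p) (indist_iff.2 (fun q => by
        simp only [addV, Set.mem_union, Set.mem_singleton_iff]; grind))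
      simp [addV] at this
  · intro hp
    have key : ∀ M', Indist M' M → (p ∈ M'.V ↔ p ∈ M.V) := fun M' h => by
      have := indist_iff.1 h p
      grind
    by_cases hv : p ∈ M.V
    · exact .inl fun M' h => (key M' h).2 hv
    · exact .inr fun M' h h' => hv ((key M' h).1 h')

/-- `M` with the truth value of `p` set to that of `A`. -/
def Model.setTo (M : Model β) (p : β) (A : Prop) : Model β :=
  ⟨M.R, M.W, {q | (q = p ∧ A) ∨ (q ≠ p ∧ q ∈ M.V)}, M.W_sub_R⟩

theorem Model.addV_eq_setTo : M.addV p = M.setTo p True := by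
  ext q <;> simp [addV, setTo]; tauto

theorem Model.delV_eq_setTo : M.delV p = M.setTo p False := by
  ext q <;> simp [delV, setTo]; tauto

theorem Model.mem_setTo {A : Prop} {q : β} :
    (q ∈ (M.setTo p A).R ↔ q ∈ M.R) ∧ (q ∈ (M.setTo p A).W ↔ q ∈ M.W) ∧
    (q ∈ (M.setTo p A).V ↔ (q = p ∧ A) ∨ (q ≠ p ∧ q ∈ M.V)) := ⟨.rfl, .rfl, .rfl⟩

theorem Model.mem_addR {q : β} :
    (q ∈ (M.addR p).R ↔ q ∈ M.R ∨ q = p) ∧ (q ∈ (M.addR p).W ↔ q ∈ M.W) ∧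
    (q ∈ (M.addR p).V ↔ q ∈ M.V) := ⟨.rfl, .rfl, .rfl⟩

theorem Model.mem_addW {q : β} :
    (q ∈ (M.addW p).R ↔ q ∈ M.R ∨ q = p) ∧ (q ∈ (M.addW p).W ↔ q ∈ M.W ∨ q = p) ∧
    (q ∈ (M.addW p).V ↔ q ∈ M.V) := ⟨.rfl, .rfl, .rfl⟩

theorem Model.mem_delR {q : β} :
    (q ∈ (M.delR p).R ↔ q ∈ M.R ∧ q ≠ p) ∧ (q ∈ (M.delR p).W ↔ q ∈ M.W ∧ q ≠ p) ∧
    (q ∈ (M.delR p).V ↔ q ∈ M.V) := ⟨.rfl, .rfl, .rfl⟩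

theorem Program.rel_assign {φ : Formula β} :
    (Program.assign p φ).Rel M N ↔ p ∈ M.W ∧ N = M.setTo p (φ.Sat M) := by
  simp only [Program.assign, Program.Rel.eq_10, Program.Rel.eq_9, Program.Rel.eq_7, Formula.Sat,
    rel_setV, rel_unsetV, addV_eq_setTo, delV_eq_setTo, and_assoc, exists_eq_left']
  by_cases h : φ.Sat M <;> simp [h]

theorem Program.rel_seqList_cons {π : Program β} {l : List (Program β)} :
    (seqList (π :: l)).Rel M N ↔ ∃ K, π.Rel M K ∧ (seqList l).Rel K N := by
  cases l with
  | nil => simp [seqList, Program.Rel, Formula.Sat]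
  | cons => simp [seqList, Program.Rel]

theorem Program.rel_seqList_nil : (seqList []).Rel M N ↔ N = M := by
  simp [seqList, Program.Rel, Formula.Sat, eq_comm]

theorem Program.rel_seq {π₁ π₂ : Program β} :
    (Program.seq π₁ π₂).Rel M N ↔ ∃ K, π₁.Rel M K ∧ π₂.Rel K N := by
  simp only [Program.Rel]

theorem Program.rel_choice {π₁ π₂ : Program β} :
    (Program.choice π₁ π₂).Rel M N ↔ π₁.Rel M N ∨ π₂.Rel M N := by
  simp only [Program.Rel]

theorem Program.rel_test {φ : Formula β} :
    (Program.test φ).Rel M N ↔ φ.Sat M ∧ N = M := by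
  simp only [Program.Rel]; tauto

theorem Formula.sat_var : (Formula.var p).Sat M ↔ p ∈ M.V := by simp only [Formula.Sat]

theorem Formula.sat_neg {φ : Formula β} : (Formula.neg φ).Sat M ↔ ¬ φ.Sat M := by
  simp only [Formula.Sat]

theorem Formula.sat_or {φ ψ : Formula β} : (Formula.or φ ψ).Sat M ↔ φ.Sat M ∨ ψ.Sat M := by
  simp only [Formula.Sat]

end Derived

/-! ### Programs that act on the fibres of the extended set of variables -/

section Fibre

variable {α : Type u}

/-- The variable from which an extended variable stems. -/
def ExtVar.root : ExtVar α → α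
  | .base p => p
  | .copy _ p => p
  | .rd _ p => p
  | .wr _ p => p

open ExtVar

theorem Side.forall {A : Side → Prop} : (∀ k, A k) ↔ A .one ∧ A .two :=
  ⟨fun h => ⟨h _, h _⟩, fun h k => by cases k; exacts [h.1, h.2]⟩

theorem ExtVar.forall_iff_root (p : α) {A : ExtVar α → Prop} :
    (∀ q, A q) ↔ (∀ q, root q ≠ p → A q) ∧ A (base p) ∧ (∀ k, A (copy k p)) ∧
      (∀ k, A (rd k p)) ∧ ∀ k, A (wr k p) := by
  refine ⟨fun h => ⟨fun q _ => h q, h _, fun _ => h _, fun _ => h _, fun _ => h _⟩, ?_⟩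
  rintro ⟨h, hb, hc, hr, hw⟩ q
  by_cases hq : root q = p
  · subst hq
    cases q with
    | base => exact hb
    | copy => exact hc _
    | rd => exact hr _
    | wr => exact hw _
  · exact h q hq

theorem Program.rel_seqList_map_iff {prog : α → Program (ExtVar α)}
    {C : α → Model (ExtVar α) → Model (ExtVar α) → Prop}
    (hprog : ∀ p N N', (prog p).Rel N N' ↔ (∀ q, root q ≠ p → Agree N q N' q) ∧ C p N N')
    (hC : ∀ p N N' K K', (∀ q, root q = p → Agree N q K q) →
      (∀ q, root q = p → Agree N' q K' q) → C p N N' → C p K K')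
    {P : List α} (hP : P.Nodup) {N N' : Model (ExtVar α)} :
    (seqList (P.map prog)).Rel N N' ↔
      (∀ q, root q ∉ P → Agree N q N' q) ∧ ∀ p ∈ P, C p N N' := by
  induction P generalizing N with
  | nil => simp [rel_seqList_nil, eq_comm (a := N'), eq_iff_agree]
  | cons p P ih =>
    rw [List.nodup_cons] at hP
    simp only [List.map_cons, rel_seqList_cons, hprog, ih hP.2, List.mem_cons, not_or,
      forall_eq_or_imp]
    constructor
    · rintro ⟨K, ⟨h₁, c₁⟩, h₂, c₂⟩
      refine ⟨fun q hq => (h₁ q hq.1).trans (h₂ q hq.2), ?_, fun p' hp' => ?_⟩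
      · exact hC p _ _ _ _ (fun q _ => Agree.refl N q) (fun q hq => h₂ q (hq ▸ hP.1)) c₁
      · refine hC p' _ _ _ _ (fun q hq => (h₁ q ?_).symm) (fun q _ => Agree.refl N' q) (c₂ p' hp')
        rintro rfl
        exact hP.1 (hq ▸ hp')
    · rintro ⟨h, c, c'⟩
      have hin : ∀ q, root q = p → Agree N' q (patch {q | root q = p} id id N' N) q :=
        fun q hq => agree_patch_of_mem (f := id) (g := id) (Set.injOn_id _) N' N hq
      have hout : ∀ q, root q ≠ p → Agree N q (patch {q | root q = p} id id N' N) q :=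
        fun q hq => agree_patch_of_notMem N' N (by simpa using hq)
      refine ⟨patch {q | root q = p} id id N' N, ⟨hout, ?_⟩, fun q hq => ?_, fun p' hp' => ?_⟩
      · exact hC p _ _ _ _ (fun q _ => Agree.refl N q) hin c
      · by_cases e : root q = p
        · exact (hin q e).symm
        · exact (hout q e).symm.trans (h q ⟨e, hq⟩)
      · refine hC p' _ _ _ _ (fun q hq => hout q ?_) (fun q _ => Agree.refl N' q) (c' p' hp')
        rintro rfl
        exact hP.1 (hq ▸ hp')

/-- The effect of `splitAt p` on the variables stemming from `p`. -/
def SplitSpec (p : α) (N N' : Model (ExtVar α)) : Prop :=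
  Agree N (base p) N' (base p) ∧ (∀ k, Agree N (rd k p) N' (rd k p)) ∧
  (∀ k, Agree N (wr k p) N' (wr k p)) ∧ (∀ k, copy k p ∈ N'.V ↔ base p ∈ N.V) ∧
  (base p ∈ N.R ↔ copy .one p ∈ N'.R ∨ copy .two p ∈ N'.R) ∧
  (base p ∈ N.W ↔ copy .one p ∈ N'.W ∨ copy .two p ∈ N'.W) ∧
  ¬ (copy .one p ∈ N'.W ∧ copy .two p ∈ N'.R) ∧ ¬ (copy .two p ∈ N'.W ∧ copy .one p ∈ N'.R)

/-- The effect of `store` on the variables stemming from `p`. -/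
def StoreSpec (p : α) (N N' : Model (ExtVar α)) : Prop :=
  Agree N (base p) N' (base p) ∧ ∀ k, Agree N (copy k p) N' (copy k p) ∧
  rd k p ∈ N'.R ∧ rd k p ∈ N'.W ∧ (rd k p ∈ N'.V ↔ copy k p ∈ N.R) ∧
  wr k p ∈ N'.R ∧ wr k p ∈ N'.W ∧ (wr k p ∈ N'.V ↔ copy k p ∈ N.W)

/-- The condition tested by `okChange` on the variables stemming from `p`. -/
def OkSpec (p : α) (N : Model (ExtVar α)) : Prop :=
  ∀ k, (rd k p ∈ N.V ↔ copy k p ∈ N.R) ∧ (wr k p ∈ N.V ↔ copy k p ∈ N.W) ∧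
    (wr k p ∉ N.V → (base p ∈ N.V ↔ copy k p ∈ N.V))

/-- The effect of `cleanAt p` on the fresh variables stemming from `p`. -/
def CleanSpec (p : α) (N N' : Model (ExtVar α)) : Prop :=
  ∀ k, rd k p ∈ N.W ∧ wr k p ∈ N.W ∧
    (copy k p ∉ N'.R ∧ copy k p ∉ N'.W ∧ copy k p ∉ N'.V) ∧
    (rd k p ∉ N'.R ∧ rd k p ∉ N'.W ∧ rd k p ∉ N'.V) ∧
    (wr k p ∉ N'.R ∧ wr k p ∉ N'.W ∧ wr k p ∉ N'.V)

/-- The effect of `mergeAt p` on the variables stemming from `p`. -/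
def MergeSpec (p : α) (N N' : Model (ExtVar α)) : Prop :=
  (base p ∈ N.R ↔ base p ∈ N'.R) ∧ (base p ∈ N.W ↔ base p ∈ N'.W) ∧
  ((base p ∉ N.W ∧ (base p ∈ N.V ↔ base p ∈ N'.V)) ∨
    (base p ∈ N.W ∧ base p ∈ N'.V ∧ ((copy .one p ∈ N.W ∧ copy .one p ∈ N.V) ∨
      (copy .two p ∈ N.W ∧ copy .two p ∈ N.V))) ∨
    (base p ∈ N.W ∧ base p ∉ N'.V ∧ ((copy .one p ∈ N.W ∧ copy .one p ∉ N.V) ∨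
      (copy .two p ∈ N.W ∧ copy .two p ∉ N.V)))) ∧
  CleanSpec p N N'

theorem sat_okChange {P : List α} {N : Model (ExtVar α)} :
    (okChange P).Sat N ↔ ∀ p ∈ P, OkSpec p N := by
  simp [okChange, OkSpec, okChangeAt, Formula.sat_bigAnd, Formula.sat_and, Formula.sat_iff,
    Formula.sat_imp, Formula.sat_neg, Formula.sat_var, Formula.sat_readable, Formula.sat_writable,
    Side.forall]

theorem rel_storeAt (p : α) (N N' : Model (ExtVar α)) :
    (Program.seqList ([Side.one, Side.two].map (storeAt p))).Rel N N' ↔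
      (∀ q, root q ≠ p → Agree N q N' q) ∧ StoreSpec p N N' := by
  simp only [List.map_cons, List.map_nil, storeAt, Program.rel_seqList_cons,
    Program.rel_seqList_nil, Program.rel_setW, Program.rel_assign, exists_eq_left, and_assoc,
    Formula.sat_readable, Formula.sat_writable]
  simp only [mem_addW, mem_setTo, or_true, true_and, reduceCtorEq, or_false,
    exists_eq_left, ne_eq]
  rw [eq_iff_agree, forall_iff_root p]
  refine and_congr (forall₂_congr fun q hq => ?_) ?_
  · have h₁ : ∀ k, q ≠ rd k p := by rintro k rfl; exact hq rfl
    have h₂ : ∀ k, q ≠ wr k p := by rintro k rfl; exact hq rfl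
    simp [Agree, h₁, h₂, mem_addW, mem_setTo, iff_comm]
  · simp only [Agree, StoreSpec, Side.forall, mem_addW, mem_setTo]
    constructor <;> (intro h; simp [h])

theorem rel_cleanAt (p : α) (N N' : Model (ExtVar α)) :
    (Program.seqList ([Side.one, Side.two].map (cleanAt p))).Rel N N' ↔
      (∀ q, root q ≠ p → Agree N q N' q) ∧ Agree N (base p) N' (base p) ∧ CleanSpec p N N' := by
  obtain ⟨K, hK⟩ : ∃ K, K =
      ((((((((((((((N.setTo (rd .one p) False).setTo (wr .one p) False).addW
      (copy .one p)).setTo (copy .one p) False).delR (rd .one p)).delR (wr .one p)).delR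
      (copy .one p)).setTo (rd .two p) False).setTo (wr .two p) False).addW
      (copy .two p)).setTo (copy .two p) False).delR (rd .two p)).delR (wr .two p)).delR
      (copy .two p)) := ⟨_, rfl⟩
  have hrel : (Program.seqList ([Side.one, Side.two].map (cleanAt p))).Rel N N' ↔
      ((rd .one p ∈ N.W ∧ wr .one p ∈ N.W) ∧ rd .two p ∈ N.W ∧ wr .two p ∈ N.W) ∧ N' = K := by
    simp only [List.map_cons, List.map_nil, cleanAt, Program.rel_seqList_cons,
      Program.rel_seqList_nil, Program.rel_setW, Program.rel_unsetV, Program.rel_unsetR,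
      delV_eq_setTo, exists_eq_left, and_assoc, hK]
    simp [mem_addW, mem_setTo, mem_delR, and_assoc]
  have ho : ∀ q, root q ≠ p → Agree N q K q := by
    intro q hq
    have h₁ : ∀ k, q ≠ rd k p := by rintro k rfl; exact hq rfl
    have h₂ : ∀ k, q ≠ wr k p := by rintro k rfl; exact hq rfl
    have h₃ : ∀ k, q ≠ copy k p := by rintro k rfl; exact hq rfl
    simp [Agree, h₁, h₂, h₃, mem_addW, mem_setTo, mem_delR, hK]
  have hb : Agree N (base p) K (base p) := by simp [Agree, mem_addW, mem_setTo, mem_delR, hK]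
  have hf : ∀ k, (copy k p ∉ K.R ∧ copy k p ∉ K.W ∧ copy k p ∉ K.V) ∧
      (rd k p ∉ K.R ∧ rd k p ∉ K.W ∧ rd k p ∉ K.V) ∧
      (wr k p ∉ K.R ∧ wr k p ∉ K.W ∧ wr k p ∉ K.V) := by
    rintro (_ | _) <;> simp [mem_addW, mem_setTo, mem_delR, hK]
  rw [hrel]
  constructor
  · rintro ⟨⟨h₁, h₂⟩, rfl⟩
    exact ⟨ho, hb, Side.forall.2 ⟨⟨h₁.1, h₁.2, hf _⟩, ⟨h₂.1, h₂.2, hf _⟩⟩⟩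
  · rintro ⟨ho', hb', hc⟩
    refine ⟨⟨⟨(hc _).1, (hc _).2.1⟩, ⟨(hc _).1, (hc _).2.1⟩⟩, ?_⟩
    rw [eq_iff_agree, forall_iff_root p]
    refine ⟨fun q hq => (ho' q hq).symm.trans (ho q hq), hb'.symm.trans hb, ?_⟩
    simp [Agree, (hc _).2.2, hf]

theorem rel_mergeAt (p : α) (N N' : Model (ExtVar α)) :
    (mergeAt p).Rel N N' ↔ (∀ q, root q ≠ p → Agree N q N' q) ∧ MergeSpec p N N' := by
  have hne : ∀ {q : ExtVar α}, root q ≠ p → q ≠ base p := by rintro _ h rfl; exact h rfl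
  simp only [mergeAt, Program.rel_choice, Program.rel_seq, rel_cleanAt, Program.rel_test,
    Program.rel_setV, Program.rel_unsetV, and_assoc, addV_eq_setTo, delV_eq_setTo, exists_eq_left,
    exists_and_left, Formula.sat_writable, Formula.sat_neg, Formula.sat_var,
    Formula.sat_and, Formula.sat_or]
  constructor
  · rintro ⟨K, ⟨h, rfl⟩ | ⟨h, h', rfl⟩ | ⟨h, h', rfl⟩, ho, hb, hc⟩
    · exact ⟨ho, hb.1, hb.2.1, .inl ⟨h, hb.2.2⟩, hc⟩
    · refine ⟨fun q hq => ?_, hb.1, hb.2.1, .inr (.inl ⟨h', ?_, h⟩), hc⟩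
      · simpa [Agree, mem_setTo, hne hq] using ho q hq
      · simpa [Agree, mem_setTo] using hb.2.2
    · refine ⟨fun q hq => ?_, hb.1, hb.2.1, .inr (.inr ⟨h', ?_, h⟩), hc⟩
      · simpa [Agree, mem_setTo, hne hq] using ho q hq
      · simpa [Agree, mem_setTo] using hb.2.2
  · rintro ⟨ho, hr, hw, ⟨h, hb⟩ | ⟨h', hb, h⟩ | ⟨h', hb, h⟩, hc⟩
    · exact ⟨N, .inl ⟨h, rfl⟩, ho, ⟨hr, hw, hb⟩, hc⟩
    · refine ⟨_, .inr (.inl ⟨h, h', rfl⟩), fun q hq => ?_, ⟨hr, hw, ?_⟩, hc⟩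
      · simpa [Agree, mem_setTo, hne hq] using ho q hq
      · simp [mem_setTo, hb]
    · refine ⟨_, .inr (.inr ⟨h, h', rfl⟩), fun q hq => ?_, ⟨hr, hw, ?_⟩, hc⟩
      · simpa [Agree, mem_setTo, hne hq] using ho q hq
      · simp [mem_setTo, hb]

theorem rel_splitAt (p : α) (N N' : Model (ExtVar α)) :
    (splitAt p).Rel N N' ↔ (∀ q, root q ≠ p → Agree N q N' q) ∧ SplitSpec p N N' := by
  have hN := @N.W_sub_R (base p)
  have hN₁ := @N'.W_sub_R (copy .one p)
  have hN₂ := @N'.W_sub_R (copy .two p)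
  obtain ⟨K, hK⟩ : ∃ K, K = (((((N.addW (copy .one p)).addW (copy .two p)).setTo (copy .one p)
    (base p ∈ N.V)).setTo (copy .two p) (base p ∈ N.V)).delR (copy .one p)).delR (copy .two p) :=
    ⟨_, rfl⟩
  have hrel : (splitAt p).Rel N N' ↔
      (base p ∉ K.R ∧ N' = K) ∨
      (base p ∈ K.W ∧ (N' = K.addW (copy .one p) ∨ N' = K.addW (copy .two p))) ∨
      (base p ∉ K.W ∧ base p ∈ K.R ∧ (N' = K.addR (copy .one p) ∨ N' = K.addR (copy .two p) ∨
        N' = (K.addR (copy .one p)).addR (copy .two p))) := by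
    simp only [splitAt, Program.rel_seqList_cons, Program.rel_choice, Program.rel_seq,
      Program.rel_test, Program.rel_seqList_nil, Program.rel_setW, Program.rel_setR,
      Program.rel_setV, Program.rel_unsetV, Program.rel_unsetR, exists_eq_left, and_assoc,
      addV_eq_setTo, delV_eq_setTo, Formula.sat_readable, Formula.sat_writable, Formula.sat_neg,
      Formula.sat_var, Formula.sat_and, hK]
    by_cases hv : base p ∈ N.V <;> simp [hv, mem_addW, mem_setTo]
  have ho : ∀ q, root q ≠ p → Agree N q K q := by
    intro q hq
    have h : ∀ k, q ≠ copy k p := by rintro k rfl; exact hq rfl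
    simp [Agree, h, mem_addW, mem_setTo, mem_delR, hK]
  have hne : ∀ {q : ExtVar α}, root q ≠ p → ∀ k, q ≠ copy k p := by rintro _ h k rfl; exact h rfl
  have hb : Agree N (base p) K (base p) := by simp [Agree, mem_addW, mem_setTo, mem_delR, hK]
  have hr : ∀ k, Agree N (rd k p) K (rd k p) := by
    simp [Agree, mem_addW, mem_setTo, mem_delR, hK]
  have hw : ∀ k, Agree N (wr k p) K (wr k p) := by
    simp [Agree, mem_addW, mem_setTo, mem_delR, hK]
  have hc : ∀ k, copy k p ∉ K.R ∧ copy k p ∉ K.W ∧ (copy k p ∈ K.V ↔ base p ∈ N.V) := by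
    rintro (_ | _) <;> simp [mem_addW, mem_setTo, mem_delR, hK]
  rw [hrel]
  clear hK hrel
  have hoff : (∀ q, root q ≠ p → Agree N q N' q) ↔ (∀ q, root q ≠ p → Agree N' q K q) :=
    forall₂_congr fun q hq => ⟨fun h => h.symm.trans (ho q hq), fun h => (ho q hq).trans h.symm⟩
  rw [hoff, SplitSpec]
  rw [Side.forall] at hc hr hw
  constructor
  · rintro (⟨h, rfl⟩ | ⟨h, rfl | rfl⟩ | ⟨h, h', rfl | rfl | rfl⟩) <;>
    refine ⟨fun q hq => by simp [Agree, mem_addW, mem_addR, hne hq], ?_⟩ <;>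
    simp only [Agree, mem_addW, mem_addR, Side.forall] at * <;>
    simp_all
  · rintro ⟨hoff', hbase, hrd, hwr, hv, hR, hW, h₁₂, h₂₁⟩
    have key : ∀ X : Model (ExtVar α), (∀ q, root q ≠ p → Agree K q X q) →
        (Agree K (base p) X (base p) ∧ (∀ k, Agree K (rd k p) X (rd k p)) ∧
          ∀ k, Agree K (wr k p) X (wr k p)) →
        (∀ k, Agree N' (copy k p) X (copy k p)) → N' = X := by
      intro X h h' h''
      rw [eq_iff_agree, forall_iff_root p]
      rw [← Side.forall (A := fun k => Agree N (rd k p) K (rd k p))] at hr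
      rw [← Side.forall (A := fun k => Agree N (wr k p) K (wr k p))] at hw
      exact ⟨fun q hq => (hoff' q hq).trans (h q hq), (hbase.symm.trans hb).trans h'.1, h'',
        fun k => ((hrd k).symm.trans (hr k)).trans (h'.2.1 k),
        fun k => ((hwr k).symm.trans (hw k)).trans (h'.2.2 k)⟩
    have hb₁ := hb.1
    have hb₂ := hb.2.1
    by_cases c₁ : copy .one p ∈ N'.W
    · refine .inr (.inl ⟨hb₂.1 (hW.2 (.inl c₁)), .inl (key _ (fun q hq => ?_) ?_ ?_)⟩)
      · simp [Agree, mem_addW, hne hq]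
      · simp [Agree, mem_addW]
      · simp only [Side.forall, Agree, mem_addW]
        simp_all
    by_cases c₂ : copy .two p ∈ N'.W
    · refine .inr (.inl ⟨hb₂.1 (hW.2 (.inr c₂)), .inr (key _ (fun q hq => ?_) ?_ ?_)⟩)
      · simp [Agree, mem_addW, hne hq]
      · simp [Agree, mem_addW]
      · simp only [Side.forall, Agree, mem_addW]
        simp_all
    have nW : base p ∉ K.W := fun h => (hW.1 (hb₂.2 h)).elim c₁ c₂
    by_cases d₁ : copy .one p ∈ N'.R <;> by_cases d₂ : copy .two p ∈ N'.R
    · refine .inr (.inr ⟨nW, hb₁.1 (hR.2 (.inl d₁)),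
        .inr (.inr (key _ (fun q hq => ?_) ?_ ?_))⟩)
      · simp [Agree, mem_addR, hne hq]
      · simp [Agree, mem_addR]
      · simp only [Side.forall, Agree, mem_addR]
        simp_all
    · refine .inr (.inr ⟨nW, hb₁.1 (hR.2 (.inl d₁)), .inl (key _ (fun q hq => ?_) ?_ ?_)⟩)
      · simp [Agree, mem_addR, hne hq]
      · simp [Agree, mem_addR]
      · simp only [Side.forall, Agree, mem_addR]
        simp_all
    · refine .inr (.inr ⟨nW, hb₁.1 (hR.2 (.inr d₂)),
        .inr (.inl (key _ (fun q hq => ?_) ?_ ?_))⟩)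
      · simp [Agree, mem_addR, hne hq]
      · simp [Agree, mem_addR]
      · simp only [Side.forall, Agree, mem_addR]
        simp_all
    · refine .inl ⟨fun h => (hR.1 (hb₁.2 h)).elim d₁ d₂, key _ (fun q _ => Agree.refl _ _) ?_ ?_⟩
      · simp [Agree]
      · simp only [Side.forall, Agree]
        simp_all

theorem rel_split {P : List α} (hP : P.Nodup) {N N' : Model (ExtVar α)} :
    (split P).Rel N N' ↔ (∀ q, root q ∉ P → Agree N q N' q) ∧ ∀ p ∈ P, SplitSpec p N N' := by
  refine Program.rel_seqList_map_iff rel_splitAt (fun p N N' K K' h h' => ?_) hP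
  rw [forall_iff_root p] at h h'
  simp only [root, Agree, Side.forall, SplitSpec, true_implies] at *
  simp_all

theorem rel_store {P : List α} (hP : P.Nodup) {N N' : Model (ExtVar α)} :
    (store P).Rel N N' ↔ (∀ q, root q ∉ P → Agree N q N' q) ∧ ∀ p ∈ P, StoreSpec p N N' := by
  refine Program.rel_seqList_map_iff rel_storeAt (fun p N N' K K' h h' => ?_) hP
  rw [forall_iff_root p] at h h'
  simp only [root, Agree, Side.forall, StoreSpec, true_implies] at *
  simp_all

theorem rel_merge {P : List α} (hP : P.Nodup) {N N' : Model (ExtVar α)} :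
    (merge P).Rel N N' ↔ (∀ q, root q ∉ P → Agree N q N' q) ∧ ∀ p ∈ P, MergeSpec p N N' := by
  refine Program.rel_seqList_map_iff rel_mergeAt (fun p N N' K K' h h' => ?_) hP
  rw [forall_iff_root p] at h h'
  simp only [root, Agree, Side.forall, MergeSpec, CleanSpec, true_implies] at *
  simp_all

theorem rel_flatten {P : List α} (hP : P.Nodup) {π₁ π₂ : Program α} {N N' : Model (ExtVar α)} :
    (flatten P π₁ π₂).Rel N N' ↔ ∃ A B C D,
      ((∀ q, root q ∉ P → Agree N q A q) ∧ ∀ p ∈ P, SplitSpec p N A) ∧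
      ((∀ q, root q ∉ P → Agree A q B q) ∧ ∀ p ∈ P, StoreSpec p A B) ∧
      (π₁.map (copy .one)).Rel B C ∧ (π₂.map (copy .two)).Rel C D ∧ (∀ p ∈ P, OkSpec p D) ∧
      ((∀ q, root q ∉ P → Agree D q N' q) ∧ ∀ p ∈ P, MergeSpec p D N') := by
  simp only [flatten, Program.rel_seqList_cons, Program.rel_seqList_nil, Program.rel_test,
    rel_split hP, rel_store hP, rel_merge hP, sat_okChange, and_assoc,
    exists_and_left, exists_eq_left, exists_eq_right_right']

/-- The model over the extended variables reached after splitting `M` into `K .one`, `K .two` and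
storing the readability and writability of the copies of the variables in `P`. -/
def storedModel (P : List α) (M : Model α) (K : Side → Model α) : Model (ExtVar α) where
  R := {q | match q with
    | .base p => p ∈ M.R
    | .copy k p => p ∈ P ∧ p ∈ (K k).R
    | .rd _ p => p ∈ P
    | .wr _ p => p ∈ P}
  W := {q | match q with
    | .base p => p ∈ M.W
    | .copy k p => p ∈ P ∧ p ∈ (K k).W
    | .rd _ p => p ∈ P
    | .wr _ p => p ∈ P}
  V := {q | match q with
    | .base p => p ∈ M.V
    | .copy k p => p ∈ P ∧ p ∈ (K k).V
    | .rd k p => p ∈ P ∧ p ∈ (K k).R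
    | .wr k p => p ∈ P ∧ p ∈ (K k).W}
  W_sub_R := by
    rintro (p | ⟨k, p⟩ | ⟨k, p⟩ | ⟨k, p⟩) h
    · exact M.W_sub_R h
    · exact ⟨h.1, (K k).W_sub_R h.2⟩
    · exact h
    · exact h

/-- The model over the extended variables reached after splitting `M` into `K .one`, `K .two`. -/
def splitModel (P : List α) (M : Model α) (K : Side → Model α) : Model (ExtVar α) where
  R := {q | match q with
    | .base p => p ∈ M.R
    | .copy k p => p ∈ P ∧ p ∈ (K k).R
    | _ => False}
  W := {q | match q with
    | .base p => p ∈ M.W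
    | .copy k p => p ∈ P ∧ p ∈ (K k).W
    | _ => False}
  V := {q | match q with
    | .base p => p ∈ M.V
    | .copy k p => p ∈ P ∧ p ∈ (K k).V
    | _ => False}
  W_sub_R := by
    rintro (p | ⟨k, p⟩ | ⟨k, p⟩ | ⟨k, p⟩) h
    · exact M.W_sub_R h
    · exact ⟨h.1, (K k).W_sub_R h.2⟩
    · exact h
    · exact h

/-- The restriction of a model along a map of variables. -/
def Model.comap {β γ : Type*} (f : β → γ) (N : Model γ) : Model β :=
  ⟨f ⁻¹' N.R, f ⁻¹' N.W, f ⁻¹' N.V, Set.preimage_mono N.W_sub_R⟩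

theorem Model.agree_comap {β γ : Type*} (f : β → γ) (N : Model γ) (p : β) :
    Agree (N.comap f) p N (f p) := ⟨.rfl, .rfl, .rfl⟩

theorem Model.agree_extend (M : Model α) (p : α) : Agree M p M.extend (base p) := by
  simp [Agree, extend]

theorem Model.notMem_extend (M : Model α) {q : ExtVar α} (hq : ∀ p, q ≠ base p) :
    q ∉ M.extend.R ∧ q ∉ M.extend.W ∧ q ∉ M.extend.V := by
  simp [extend, fun p => (hq p).symm]

variable [DecidableEq α] {P : List α} {π₁ π₂ : Program α}

theorem rel_flatten_of_rel_par (hP : P.Nodup) (hvars : P.toFinset = (Program.par π₁ π₂).vars)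
    {M M' : Model α} (h : (Program.par π₁ π₂).Rel M M') :
    (flatten P π₁ π₂).Rel M.extend M'.extend := by
  simp only [Program.Rel] at h
  obtain ⟨M₁, M₂, M₁', M₂', hs, hm, r₁, l₁, r₂, l₂⟩ := h
  have hv : (π₁.vars : Set α) ⊆ {p | p ∈ P} ∧ (π₂.vars : Set α) ⊆ {p | p ∈ P} := by
    rw [← Set.union_subset_iff, ← Finset.coe_union]
    intro p hp
    have : p ∈ P.toFinset := hvars ▸ hp
    simpa using this
  rw [← Program.map_id π₁] at r₁
  rw [← Program.map_id π₂] at r₂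
  have inj : ∀ k, Set.InjOn (copy k) {p : α | p ∈ P} := fun k p _ p' _ e => by
    simpa using e
  set K : Side → Model α := fun k => match k with | .one => M₁ | .two => M₂ with hK
  have ag₁ : AgreeOn {p | p ∈ P} id (copy .one) M₁ (storedModel P M K) := fun p hp => by
    simp_all [Agree, storedModel]
  obtain ⟨C, rC, aC, oC⟩ := Program.exists_rel_map_of_agreeOn π₁ hv.1 (Set.injOn_id _) (inj .one)
    ag₁ r₁
  have oC' : ∀ q, (∀ p, q ≠ copy .one p) → Agree (storedModel P M K) q C q := fun q hq =>
    oC q (by rintro ⟨p, -, rfl⟩; exact hq p rfl)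
  have ag₂ : AgreeOn {p | p ∈ P} id (copy .two) M₂ C := fun p hp => by
    refine Agree.trans ?_ (oC' _ (by simp))
    simp_all [Agree, storedModel]
  obtain ⟨D, rD, aD, oD⟩ := Program.exists_rel_map_of_agreeOn π₂ hv.2 (Set.injOn_id _) (inj .two)
    ag₂ r₂
  have oD' : ∀ q, (∀ p, q ≠ copy .two p) → Agree C q D q := fun q hq =>
    oD q (by rintro ⟨p, -, rfl⟩; exact hq p rfl)
  have hD : ∀ q, (∀ k p, q ≠ copy k p) → Agree (storedModel P M K) q D q := fun q hq =>
    (oC' q (hq _)).trans (oD' q (hq _))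
  rw [split_iff] at hs
  rw [merge_iff] at hm
  rw [legalChange_iff] at l₁ l₂
  have hD' : ∀ p ∈ P, (Agree (storedModel P M K) (base p) D (base p) ∧
      (∀ k, Agree (storedModel P M K) (rd k p) D (rd k p)) ∧
      ∀ k, Agree (storedModel P M K) (wr k p) D (wr k p)) ∧
      Agree M₁' (id p) D (copy .one p) ∧ Agree M₂' (id p) D (copy .two p) := fun p hp =>
    ⟨⟨hD _ (by simp), fun k => hD _ (by simp), fun k => hD _ (by simp)⟩,
      (aC p hp).trans (oD' _ (by simp)), aD p hp⟩
  refine (rel_flatten hP).2 ⟨splitModel P M K, storedModel P M K, C, D, ⟨?_, fun p hp => ?_⟩,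
    ⟨?_, fun p hp => ?_⟩, rC, rD, fun p hp => ?_, ?_, fun p hp => ?_⟩
  · rintro (p | ⟨k, p⟩ | ⟨k, p⟩ | ⟨k, p⟩) hq <;> simp [root] at hq <;>
      simp [Agree, extend, splitModel, hq]
  · have key := hs p
    simp only [SplitSpec, Agree, extend, splitModel, Side.forall, hK]
    clear * - key hp
    simp
    grind
  · rintro (p | ⟨k, p⟩ | ⟨k, p⟩ | ⟨k, p⟩) hq <;> simp [root] at hq <;>
      simp [Agree, storedModel, splitModel, hq]
  · simp [StoreSpec, Agree, storedModel, splitModel, hp]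
  · have key := And.intro (hs p) <| And.intro (l₁ p) <| And.intro (l₂ p) (hD' p hp)
    clear_value K
    subst hK
    clear * - key hp
    simp only [OkSpec, Agree, storedModel, Side.forall, id, Set.mem_ofPred_eq] at key ⊢
    grind
  · intro q hq
    have : Agree (storedModel P M K) q D q := by
      refine (oC q ?_).trans (oD q ?_) <;> (rintro ⟨p, hp, rfl⟩; exact hq hp)
    refine this.symm.trans ?_
    cases q with
    | base p =>
      refine Agree.trans (N := M) (q := p) ⟨.rfl, .rfl, .rfl⟩ (Agree.trans ?_ (agree_extend M' p))
      have key := And.intro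
        (Program.agree_of_rel_map id {p | p ∈ P} π₁ hv.1 _ _ r₁ p (by simpa [root] using hq)) <| And.intro
        (Program.agree_of_rel_map id {p | p ∈ P} π₂ hv.2 _ _ r₂ p (by simpa [root] using hq)) <|
        And.intro (hs p) (hm p)
      clear * - key
      simp only [Agree] at key ⊢
      grind
    | copy k p => simp [root] at hq; simp [Agree, storedModel, extend, hq]
    | rd k p => simp [root] at hq; simp [Agree, storedModel, extend, hq]
    | wr k p => simp [root] at hq; simp [Agree, storedModel, extend, hq]
  · have key := And.intro (hs p) <| And.intro (l₁ p) <| And.intro (l₂ p) <|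
      And.intro (hD' p hp) <| And.intro (hm p) (agree_extend M' p)
    have hf := fun (q : ExtVar α) (hq : ∀ p, q ≠ base p) => notMem_extend M' hq
    refine ⟨?_, ?_, ?_, Side.forall.2 ⟨⟨?_, ?_, hf _ (by simp), hf _ (by simp), hf _ (by simp)⟩,
      ⟨?_, ?_, hf _ (by simp), hf _ (by simp), hf _ (by simp)⟩⟩⟩
    all_goals
      clear_value K
      subst hK
      clear * - key hp
      simp only [Agree, storedModel, Side.forall, id, Set.mem_ofPred_eq] at key ⊢
      grind

theorem rel_par_of_rel_flatten (hP : P.Nodup) (hvars : P.toFinset = (Program.par π₁ π₂).vars)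
    {M : Model α} {N : Model (ExtVar α)} (h : (flatten P π₁ π₂).Rel M.extend N) :
    (Program.par π₁ π₂).Rel M (N.comap base) ∧ N = (N.comap base).extend := by
  obtain ⟨A, B, C, D, ⟨oA, sA⟩, ⟨oB, sB⟩, r₁, r₂, ok, oN, sN⟩ := (rel_flatten hP).1 h
  have hv : (π₁.vars : Set α) ⊆ {p | p ∈ P} ∧ (π₂.vars : Set α) ⊆ {p | p ∈ P} := by
    rw [← Set.union_subset_iff, ← Finset.coe_union]
    intro p hp
    have : p ∈ P.toFinset := hvars ▸ hp
    simpa using this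
  have oC := Program.agree_of_rel_map (copy .one) {p | p ∈ P} π₁ hv.1 _ _ r₁
  have oD := Program.agree_of_rel_map (copy .two) {p | p ∈ P} π₂ hv.2 _ _ r₂
  have oC' : ∀ q, (∀ p, q ≠ copy .one p) → Agree B q C q := fun q hq =>
    oC q (by rintro ⟨p, -, rfl⟩; exact hq p rfl)
  have oD' : ∀ q, (∀ p, q ≠ copy .two p) → Agree C q D q := fun q hq =>
    oD q (by rintro ⟨p, -, rfl⟩; exact hq p rfl)
  have hD : ∀ q, (∀ k p, q ≠ copy k p) → Agree B q D q := fun q hq =>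
    (oC' q (hq _)).trans (oD' q (hq _))
  have hout : ∀ q, root q ∉ P → Agree M.extend q N q := by
    intro q hq
    have : Agree B q D q := by
      refine (oC q ?_).trans (oD q ?_) <;> (rintro ⟨p, hp, rfl⟩; exact hq hp)
    exact (((oA q hq).trans (oB q hq)).trans this).trans (oN q hq)
  have inj : ∀ k, Set.InjOn (copy k) {p : α | p ∈ P} := fun k p _ p' _ e => by
    simpa using e
  refine ⟨?_, ?_⟩
  · obtain ⟨M₁, a₁, o₁⟩ := exists_update (S := {p | p ∈ P}) (f := copy .one) (g := id)
      (Set.injOn_id _) B M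
    obtain ⟨M₂, a₂, o₂⟩ := exists_update (S := {p | p ∈ P}) (f := copy .two) (g := id)
      (Set.injOn_id _) C ⟨∅, ∅, M.V, subset_rfl⟩
    obtain ⟨M₁', r₁', a₁', o₁'⟩ := Program.exists_rel_map_of_agreeOn π₁ hv.1 (inj .one)
      (Set.injOn_id _) a₁ r₁
    obtain ⟨M₂', r₂', a₂', o₂'⟩ := Program.exists_rel_map_of_agreeOn π₂ hv.2 (inj .two)
      (Set.injOn_id _) a₂ r₂
    rw [Program.map_id] at r₁' r₂'
    rw [Set.image_id] at o₁ o₂ o₁' o₂'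
    have hfix : ∀ p ∈ P, (Agree M.extend (base p) A (base p) ∧
        (∀ k, (copy k p ∈ A.V ↔ base p ∈ M.extend.V) ∧ (copy k p ∈ A.W → copy k p ∈ A.R)) ∧
        (base p ∈ M.extend.R ↔ copy .one p ∈ A.R ∨ copy .two p ∈ A.R) ∧
        (base p ∈ M.extend.W ↔ copy .one p ∈ A.W ∨ copy .two p ∈ A.W) ∧
        ¬ (copy .one p ∈ A.W ∧ copy .two p ∈ A.R) ∧
        ¬ (copy .two p ∈ A.W ∧ copy .one p ∈ A.R)) ∧ StoreSpec p A B ∧ OkSpec p D ∧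
        Agree M p M.extend (base p) ∧ Agree B (base p) D (base p) ∧
        (∀ k, Agree B (rd k p) D (rd k p)) ∧ (∀ k, Agree B (wr k p) D (wr k p)) ∧
        (Agree B (copy .one p) M₁ p ∧ Agree B (copy .two p) M₂ p) ∧
        Agree D (copy .one p) M₁' p ∧ Agree D (copy .two p) M₂' p := fun p hp =>
      ⟨⟨(sA p hp).1, fun k => ⟨(sA p hp).2.2.2.1 k, @A.W_sub_R _⟩, (sA p hp).2.2.2.2⟩, sB p hp,
        ok p hp, agree_extend M p, hD _ (by simp), fun k => hD _ (by simp), fun k => hD _ (by simp),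
        ⟨a₁ p hp, (oC' _ (by simp)).trans (a₂ p hp)⟩,
        (oD' _ (by simp)).symm.trans (a₁' p hp), a₂' p hp⟩
    simp only [Program.Rel]
    refine ⟨M₁, M₂, M₁', M₂', split_iff.2 fun p => ?_, merge_iff.2 fun p => ?_, r₁',
      legalChange_iff.2 fun p => ?_, r₂', legalChange_iff.2 fun p => ?_⟩ <;>
    by_cases hp : p ∈ P
    · have key := (hfix p hp)
      clear * - key hp
      simp only [StoreSpec, OkSpec, Side.forall, Agree] at key ⊢
      grind
    · have key := And.intro (o₁ p hp) <|
        (o₂ p hp)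
      clear * - key hp
      simp only [Agree, Set.mem_empty_iff_false] at key ⊢
      grind
    · have key := And.intro (hfix p hp) <|
        And.intro ((sN p hp).2.2.1) <|
        And.intro (And.intro (sN p hp).1 (sN p hp).2.1) <|
        (agree_comap base N p)
      clear * - key hp
      simp only [StoreSpec, OkSpec, Side.forall, Agree] at key ⊢
      grind
    · have key := And.intro ((agree_extend M p).trans ((hout (base p) hp).trans (agree_comap base N p).symm)) <|
        And.intro (o₁ p hp) <|
        And.intro (o₂ p hp) <|
        And.intro (o₁' p hp) <|
        And.intro (o₂' p hp) <|
        (@M.W_sub_R p)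
      clear * - key hp
      simp only [Agree] at key ⊢
      grind
    · have key := (hfix p hp)
      clear * - key hp
      simp only [StoreSpec, OkSpec, Side.forall, Agree] at key ⊢
      grind
    · have key := (o₁' p hp)
      clear * - key hp
      simp only [Agree] at key ⊢
      grind
    · have key := (hfix p hp)
      clear * - key hp
      simp only [StoreSpec, OkSpec, Side.forall, Agree] at key ⊢
      grind
    · have key := (o₂' p hp)
      clear * - key hp
      simp only [Agree] at key ⊢
      grind
  · refine eq_iff_agree.2 fun q => ?_
    have hfresh : (∀ p, q ≠ base p) → Agree N q (N.comap base).extend q := by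
      intro hq
      have : q ∉ N.R ∧ q ∉ N.W ∧ q ∉ N.V := by
        by_cases hp : root q ∈ P
        · have := (sN _ hp).2.2.2
          cases q with
          | base p => exact absurd rfl (hq p)
          | copy k p => exact (this k).2.2.1
          | rd k p => exact (this k).2.2.2.1
          | wr k p => exact (this k).2.2.2.2
        · simpa [Agree, notMem_extend M hq] using hout q hp
      simp [Agree, this, notMem_extend _ hq]
    cases q with
    | base p => exact (agree_comap base N p).symm.trans (agree_extend _ p)
    | copy k p | rd k p | wr k p => exact hfresh (by simp)

end Fibre

end DLPA

theorem mainTheorem5 {α : Type*} [DecidableEq α] (π₁ π₂ : DLPA.Program α)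
    (P : List α) (hnodup : P.Nodup) (hP : P.toFinset = (DLPA.Program.par π₁ π₂).vars)
    (M : DLPA.Model α) :
    (∀ M' : DLPA.Model α,
      (DLPA.Program.par π₁ π₂).Rel M M' ↔
        (DLPA.flatten P π₁ π₂).Rel M.extend M'.extend) ∧
    (∀ N : DLPA.Model (DLPA.ExtVar α),
      (DLPA.flatten P π₁ π₂).Rel M.extend N → ∃ M' : DLPA.Model α, N = M'.extend) := by
  refine ⟨fun M' => ⟨DLPA.rel_flatten_of_rel_par hnodup hP, fun h => ?_⟩, fun N h =>
    ⟨_, (DLPA.rel_par_of_rel_flatten hnodup hP h).2⟩⟩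
  have h' := (DLPA.rel_par_of_rel_flatten hnodup hP h).1
  have e : M'.extend.comap DLPA.ExtVar.base = M' :=
    DLPA.Model.eq_iff_agree.2 fun p =>
      (DLPA.Model.agree_comap _ _ p).trans (DLPA.Model.agree_extend M' p).symm
  rwa [e] at h'
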